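/- All topological spaces are assumed to be Tychonoff (completely regular and Hausdorff). In the open-open game on a space $X$, players I and II play countably many rounds $n=0,1,2,\dots$; in round $n$ player I chooses a non-empty open set $W_n\subset X$ and then player II chooses a non-empty open set $U_n\subset W_n$. Player I wins if $\bigcup_{n\ge 0}U_n$ is dense in $X$. The space $X$ is called $\mathrm{I}$-favorable if player I has a winning strategy, i.e. there is a function $\sigma$ assigning to every finite (possibly empty) sequence of non-empty open subsets of $X$ a non-empty open subset of $X$ such that $\bigcup_{n\ge0}U_n$ is dense in $X$ for every sequence $(U_n)_{n\ge 0}$ of non-empty open subsets of $X$ with $U_n\subset\sigma(U_0,\dots,U_{n-1})$ for all $n\ge 0$ (for $n=0$ this reads $U_0\subset\sigma(\varnothing)$). An embedding of $X$ in a space $Y$ (with $X$ identified with its image) is called $\pi$-regular if there is a function $\mathrm{e}\colon\mathcal T_X\to\mathcal T_Y$ between the topologies of $X$ and $Y$ such that for all $U,V\in\mathcal T_X$: (i) $\mathrm{e}(U)\cap \mathrm{e}(V)=\varnothing$ whenever $U\cap V=\varnothing$; (ii) $\mathrm{e}(U)\cap X$ is a dense subset of $U$. **Proposition 2.7.** Let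 $X$ be a compact $\mathrm{I}$-favorable space. Then every embedding of $X$ in another space $Y$ is $\pi$-regular. -/

import Mathlib

/-- The non-empty open subsets of `X`: the legal moves of the open-open game. -/
def NonemptyOpen (X : Type*) [TopologicalSpace X] : Type _ :=
  {U : TopologicalSpace.Opens X // (U : Set X).Nonempty}

/-- The underlying set of a move. -/
def NonemptyOpen.toSet {X : Type*} [TopologicalSpace X] (U : NonemptyOpen X) : Set X :=
  (U.1 : Set X)

/-- A strategy for player I in the open-open game on `X`: it maps the finite list
`[U₀, …, Uₙ₋₁]` of the moves made so far by player II to the next move of player I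
(a non-empty open set). The value at the empty list is the first move of player I. -/
abbrev OpenOpenStrategy (X : Type*) [TopologicalSpace X] : Type _ :=
  List (NonemptyOpen X) → NonemptyOpen X

/-- The sequence `U₀, U₁, …` of moves of player II is legal against the strategy `σ`:
`Uₙ ⊆ σ(U₀, …, Uₙ₋₁)` for every `n`. -/
def OpenOpenStrategy.IsPlay {X : Type*} [TopologicalSpace X] (σ : OpenOpenStrategy X)
    (U : ℕ → NonemptyOpen X) : Prop :=
  ∀ n : ℕ, (U n).toSet ⊆ (σ ((List.range n).map U)).toSet

/-- The strategy `σ` is winning for player I: in every game played according to `σ`, the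
union of the sets chosen by player II is dense in `X`. -/
def OpenOpenStrategy.IsWinning {X : Type*} [TopologicalSpace X] (σ : OpenOpenStrategy X) :
    Prop :=
  ∀ U : ℕ → NonemptyOpen X, σ.IsPlay U → Dense (⋃ n, (U n).toSet)

/-- `X` is I-favorable: player I has a winning strategy in the open-open game on `X`. -/
def IFavorable (X : Type*) [TopologicalSpace X] : Prop :=
  ∃ σ : OpenOpenStrategy X, σ.IsWinning

/-- The embedding `i : X → Y` is π-regular: there is a function `e` from the topology of `X`
to the topology of `Y` such that
(i) `e U` and `e V` are disjoint whenever `U` and `V` are disjoint;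
(ii) the trace `i ⁻¹(e U)` of `e U` on `X` is a dense subset of `U`. -/
def IsPiRegularEmbedding {X Y : Type*} [TopologicalSpace X] [TopologicalSpace Y]
    (i : X → Y) : Prop :=
  Topology.IsEmbedding i ∧
    ∃ e : TopologicalSpace.Opens X → TopologicalSpace.Opens Y,
      (∀ U V : TopologicalSpace.Opens X,
        (U : Set X) ∩ V = ∅ → (e U : Set Y) ∩ e V = ∅) ∧
      ∀ U : TopologicalSpace.Opens X,
        i ⁻¹' (e U : Set Y) ⊆ U ∧ (U : Set X) ⊆ closure (i ⁻¹' (e U : Set Y))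

open Set TopologicalSpace

/-! The nonempty cozero sets form a π-base of `X`, so it suffices to lift them to `Y` preserving
disjointness. For countably many of them, the defining functions extend to `Y` and map it to a
metrizable space, where comparing distances gives a lift (`HasDisjointLift.of_countable`).

In general, a winning strategy yields finitary operations whose closed families are regular:
otherwise player II could answer inside the family and always miss a fixed open set
(`isRegularSubfamily_of_isWinning`). By induction on cardinality, an uncountable closed family is a
well-ordered increasing union of smaller closed ones. Their unrelated lifts are glued by cutting
each down to earlier lifts of reductions (`HasDisjointLift.of_rank`). -/

/-- `S` is a regular subfamily of the family `s` of open sets: every nonempty open set `U` has a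
reduction in `S`. -/
def IsRegularSubfamily {X α : Type*} [TopologicalSpace X] (s : α → Set X) (S : Set α) : Prop :=
  ∀ U : Set X, IsOpen U → U.Nonempty →
    ∃ a ∈ S, ∀ b ∈ S, Disjoint (s b) U → Disjoint (s b) (s a)

/-- The sets `s a`, `a ∈ S`, extend to open subsets of `Y` up to dense subsets, with disjointness
preserved. -/
def HasDisjointLift {X Y α : Type*} [TopologicalSpace X] [TopologicalSpace Y] (i : X → Y)
    (s : α → Set X) (S : Set α) : Prop :=
  ∃ e : α → Set Y, (∀ a ∈ S, IsOpen (e a)) ∧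
    (∀ a ∈ S, ∀ b ∈ S, Disjoint (s a) (s b) → Disjoint (e a) (e b)) ∧
    ∀ a ∈ S, i ⁻¹' e a ⊆ s a ∧ s a ⊆ closure (i ⁻¹' e a)

/-! ### Gluing lifts along a well-order -/

section Gluing

variable {X Y α ι : Type*} [TopologicalSpace X] [TopologicalSpace Y]

/-- The set `g (r a) a` is cut down to the union of the `e b`, for `b` of smaller rank such that `s
b` misses every earlier `s c` that `s a` misses. Disjointness thus descends in rank, and regularity
supplies enough such `b` for density. -/
theorem HasDisjointLift.of_rank [LinearOrder ι] [WellFoundedLT ι] {i : X → Y} (hi : Continuous i)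
    {s : α → Set X} (hs : ∀ a, IsOpen (s a)) (hne : ∀ a, (s a).Nonempty) {T : Set α} (r : α → ι)
    (g : ι → α → Set Y)
    (hgo : ∀ a ∈ T, IsOpen (g (r a) a))
    (hgd : ∀ a ∈ T, ∀ b ∈ T, r a = r b → Disjoint (s a) (s b) →
      Disjoint (g (r a) a) (g (r b) b))
    (hgs : ∀ a ∈ T, i ⁻¹' g (r a) a ⊆ s a ∧ s a ⊆ closure (i ⁻¹' g (r a) a))
    (hreg : ∀ j, (∃ k, k < j) → IsRegularSubfamily s {a | a ∈ T ∧ r a < j}) :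
    HasDisjointLift i s T := by
  classical
  obtain ⟨e, he⟩ : ∃ e : α → Set Y, ∀ a, e a = g (r a) a ∩
      -- The premise voids the cut at the least rank, which has no predecessors.
      {y | (∃ k, k < r a) → ∃ b, b ∈ T ∧ r b < r a ∧
        (∀ c ∈ T, r c < r a → Disjoint (s c) (s a) → Disjoint (s c) (s b)) ∧ y ∈ e b} := by
    have wf : WellFounded (InvImage (· < ·) r : α → α → Prop) := InvImage.wf r wellFounded_lt
    refine ⟨wf.fix (C := fun _ => Set Y) fun a ih => g (r a) a ∩
      {y | (∃ k, k < r a) → ∃ b, ∃ _ : b ∈ T, ∃ h : r b < r a,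
        (∀ c ∈ T, r c < r a → Disjoint (s c) (s a) → Disjoint (s c) (s b)) ∧ y ∈ ih b h}, ?_⟩
    intro a
    rw [wf.fix_eq]
    simp only [exists_prop]
  have hopen : ∀ j, ∀ a ∈ T, r a = j → IsOpen (e a) := by
    intro j
    induction j using WellFoundedLT.induction with
    | ind j ih =>
      rintro a ha rfl
      rw [he]
      refine (hgo a ha).inter ?_
      by_cases hk : ∃ k, k < r a
      · rw [isOpen_iff_forall_mem_open]
        intro y hy
        obtain ⟨b, hb, hba, hgood, hyb⟩ := hy hk
        exact ⟨e b, fun z hz _ => ⟨b, hb, hba, hgood, hz⟩, ih _ hba b hb rfl, hyb⟩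
      · simp [hk]
  have hdis : ∀ j, ∀ a ∈ T, ∀ b ∈ T, r a = j → r b ≤ j → Disjoint (s a) (s b) →
      Disjoint (e a) (e b) := by
    intro j
    induction j using WellFoundedLT.induction with
    | ind j ih =>
      rintro a ha b hb rfl hba hab
      rcases hba.eq_or_lt with h | h
      · rw [he a, he b]
        exact (hgd a ha b hb h.symm hab).mono inter_subset_left inter_subset_left
      · rw [Set.disjoint_left]
        intro y hya hyb
        rw [he] at hya
        obtain ⟨c, hc, hca, hgood, hyc⟩ := hya.2 ⟨_, h⟩
        have hbc := hgood b hb h hab.symm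
        rcases le_total (r b) (r c) with h' | h'
        · exact Set.disjoint_left.1 (ih _ hca c hc b hb rfl h' hbc.symm) hyc hyb
        · exact Set.disjoint_left.1 (ih _ h b hb c hc rfl h' hbc) hyb hyc
  have hdense : ∀ j, ∀ a ∈ T, r a = j → s a ⊆ closure (i ⁻¹' e a) := by
    intro j
    induction j using WellFoundedLT.induction with
    | ind j ih =>
      rintro a ha rfl x hx
      rw [mem_closure_iff]
      intro O hO hxO
      by_cases hk : ∃ k, k < r a
      -- A reduction of `O ∩ s a` is also one of `s a`, and it meets `O ∩ s a`: otherwise `s b`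
      -- would be disjoint from itself.
      · obtain ⟨b, ⟨hb, hba⟩, hgood⟩ := hreg _ hk (O ∩ s a) (hO.inter (hs a)) ⟨x, hxO, hx⟩
        have hmeet : (s b ∩ (O ∩ s a)).Nonempty := by
          rw [← Set.not_disjoint_iff_nonempty_inter]
          intro hd
          have := hgood b ⟨hb, hba⟩ hd
          rw [disjoint_self] at this
          exact (hne b).ne_empty this
        obtain ⟨z, hzb, hzO, hza⟩ := hmeet
        obtain ⟨w, ⟨hwO, hwa⟩, hwb⟩ := mem_closure_iff.1 (ih _ hba b hb rfl hzb) (O ∩ s a)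
          (hO.inter (hs a)) ⟨hzO, hza⟩
        obtain ⟨v, ⟨hvO, hvb⟩, hvg⟩ := mem_closure_iff.1 ((hgs a ha).2 hwa) (O ∩ i ⁻¹' e b)
          (hO.inter ((hopen _ b hb rfl).preimage hi)) ⟨hwO, hwb⟩
        refine ⟨v, hvO, ?_⟩
        rw [mem_preimage, he]
        exact ⟨hvg, fun _ => ⟨b, hb, hba, fun c hc hca hd =>
          hgood c ⟨hc, hca⟩ (hd.mono_right inter_subset_right), hvb⟩⟩
      · obtain ⟨v, hvO, hvg⟩ := mem_closure_iff.1 ((hgs a ha).2 hx) O hO hxO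
        refine ⟨v, hvO, ?_⟩
        rw [mem_preimage, he]
        exact ⟨hvg, fun h => (hk h).elim⟩
  refine ⟨e, fun a ha => hopen _ a ha rfl, fun a ha b hb hab => ?_, fun a ha =>
    ⟨fun x hx => ?_, hdense _ a ha rfl⟩⟩
  · rcases le_total (r b) (r a) with h | h
    · exact hdis _ a ha b hb rfl h hab
    · exact (hdis _ b hb a ha rfl h hab.symm).symm
  · rw [mem_preimage, he] at hx
    exact (hgs a ha).1 hx.1

/-- Lifts of a well-ordered sequence of families, all of whose initial unions are regular, can be
glued to a lift of the union. -/
theorem HasDisjointLift.iUnion [LinearOrder ι] [WellFoundedLT ι] [Nonempty ι] {i : X → Y}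
    (hi : Continuous i) {s : α → Set X} (hs : ∀ a, IsOpen (s a)) (hne : ∀ a, (s a).Nonempty)
    {C : ι → Set α} (hC : ∀ j, HasDisjointLift i s (C j))
    (hreg : ∀ j, (∃ k, k < j) → IsRegularSubfamily s (⋃ k : Iio j, C k.1)) :
    HasDisjointLift i s (⋃ j, C j) := by
  have hr : ∀ a, ∃ j, a ∈ ⋃ j, C j → a ∈ C j ∧ ∀ k, a ∈ C k → j ≤ k := by
    intro a
    by_cases ha : a ∈ ⋃ j, C j
    · have hA : {j | a ∈ C j}.Nonempty := mem_iUnion.1 ha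
      have wf : WellFounded ((· < ·) : ι → ι → Prop) := wellFounded_lt
      exact ⟨wf.min _ hA, fun _ => ⟨wf.min_mem _ hA, fun k hk => wf.min_le hk⟩⟩
    · exact ⟨Classical.arbitrary ι, fun h => (ha h).elim⟩
  choose r hr using hr
  choose g hgo hgd hgs using hC
  refine HasDisjointLift.of_rank hi hs hne r g (fun a ha => hgo _ a (hr a ha).1)
    (fun a ha b hb hab hd => ?_) (fun a ha => hgs _ a (hr a ha).1) fun j hj => ?_
  · have hb' := (hr b hb).1
    rw [← hab] at hb' ⊢
    exact hgd _ a (hr a ha).1 b hb' hd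
  · convert hreg j hj using 1
    ext a
    simp only [mem_ofPred_eq, mem_iUnion, Subtype.exists, mem_Iio, exists_prop]
    constructor
    · rintro ⟨ha, haj⟩
      exact ⟨r a, haj, (hr a (mem_iUnion.2 ha)).1⟩
    · rintro ⟨k, hk, hak⟩
      exact ⟨⟨k, hak⟩, ((hr a (mem_iUnion.2 ⟨k, hak⟩)).2 k hak).trans_lt hk⟩

end Gluing

/-! ### Closure under finitary operations -/

section Closure

universe u

variable {α : Type u} {κ : Type}

/-- `S` is closed under the finitary operations `F k`. -/
def IsClosedUnderLists (F : κ → List α → α) (S : Set α) : Prop :=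
  ∀ k l, (∀ a ∈ l, a ∈ S) → F k l ∈ S

theorem exists_forall_mem_of_monotone {ι : Type*} [LinearOrder ι] [Nonempty ι] {C : ι → Set α}
    (hmono : Monotone C) {l : List α} (hl : ∀ a ∈ l, a ∈ ⋃ j, C j) :
    ∃ j, ∀ a ∈ l, a ∈ C j := by
  induction l with
  | nil => exact ⟨Classical.arbitrary ι, by simp⟩
  | cons a l ih =>
    obtain ⟨j, hj⟩ := ih fun b hb => hl b (List.mem_cons_of_mem _ hb)
    obtain ⟨m, hm⟩ := mem_iUnion.1 (hl a List.mem_cons_self)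
    refine ⟨max j m, fun b hb => ?_⟩
    rcases List.mem_cons.1 hb with rfl | hb
    · exact hmono (le_max_right _ _) hm
    · exact hmono (le_max_left _ _) (hj b hb)

theorem IsClosedUnderLists.iUnion {ι : Type*} [LinearOrder ι] [Nonempty ι] {F : κ → List α → α}
    {C : ι → Set α} (hmono : Monotone C) (hC : ∀ j, IsClosedUnderLists F (C j)) :
    IsClosedUnderLists F (⋃ j, C j) := by
  intro k l hl
  obtain ⟨j, hj⟩ := exists_forall_mem_of_monotone hmono hl
  exact mem_iUnion.2 ⟨j, hC j k l hj⟩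

/-- The closure of `S` under the operations `F k`. -/
def listClosure (F : κ → List α → α) (S : Set α) : Set α :=
  ⋂₀ {T | S ⊆ T ∧ IsClosedUnderLists F T}

theorem subset_listClosure (F : κ → List α → α) (S : Set α) : S ⊆ listClosure F S :=
  subset_sInter fun _ hT => hT.1

theorem isClosedUnderLists_listClosure (F : κ → List α → α) (S : Set α) :
    IsClosedUnderLists F (listClosure F S) :=
  fun k l hl T hT => hT.2 k l fun a ha => hl a ha T hT

theorem listClosure_subset {F : κ → List α → α} {S T : Set α} (hST : S ⊆ T)
    (hT : IsClosedUnderLists F T) : listClosure F S ⊆ T :=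
  sInter_subset_of_mem ⟨hST, hT⟩

-- Countably many rounds of adjoining all values on finite lists exhaust the closure, and each round
-- respects the bound.
open Cardinal in
theorem mk_listClosure_le [Countable κ] (F : κ → List α → α) (S : Set α) :
    #(listClosure F S) ≤ max #S ℵ₀ := by
  let step : Set α → Set α := fun A =>
    A ∪ range fun p : κ × List A => F p.1 (p.2.map Subtype.val)
  let C : ℕ → Set α := fun n => step^[n] S
  have hsucc : ∀ n, C (n + 1) = step (C n) := fun n => Function.iterate_succ_apply' _ _ _
  have hmono : Monotone C := monotone_nat_of_le_succ fun n => by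
    rw [hsucc]; exact subset_union_left
  have hcl : IsClosedUnderLists F (⋃ n, C n) := by
    intro k l hl
    obtain ⟨j, hj⟩ := exists_forall_mem_of_monotone hmono hl
    refine mem_iUnion.2 ⟨j + 1, ?_⟩
    rw [hsucc]
    refine Or.inr ⟨(k, l.attach.map fun a => ⟨a.1, hj a.1 a.2⟩), ?_⟩
    simp [List.map_map, Function.comp_def]
  have hcard : ∀ n, #(C n) ≤ max #S ℵ₀ := by
    intro n
    induction n with
    | zero => exact le_max_left _ _
    | succ n ih =>
      rw [hsucc]
      refine (mk_union_le _ _).trans ?_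
      refine add_le_of_le (le_max_right _ _) ih ?_
      have h : #(κ × List (C n)) ≤ max #S ℵ₀ := by
        rw [mk_prod]
        refine mul_le_of_le (le_max_right _ _) ?_ ?_
        · refine le_trans ?_ (le_max_right _ _)
          rw [lift_le_aleph0]
          exact mk_le_aleph0
        · rw [lift_uzero]
          refine (mk_list_le_max _).trans ?_
          exact max_le (le_max_right _ _) ih
      exact mk_range_le.trans h
  refine (mk_le_mk_of_subset (listClosure_subset (subset_iUnion C 0) hcl)).trans ?_
  have h := mk_iUnion_le_lift C
  rw [lift_uzero] at h
  refine h.trans ?_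
  refine mul_le_of_le (le_max_right _ _) (by simp) ?_
  exact ciSup_le' fun n => by simpa using hcard n

end Closure

/-! ### Countable families of cozero sets -/

section CountableFamilies

variable {X Y α : Type*} [TopologicalSpace X] [TopologicalSpace Y]

/-- By compactness the image of `X` is closed in the normal space βY, where Tietze's theorem
applies. -/
theorem exists_continuous_extension_of_compact [CompactSpace X] [T35Space Y] {i : X → Y}
    (hi : Topology.IsEmbedding i) (f : C(X, ℝ)) : ∃ g : C(Y, ℝ), ∀ x, g (i x) = f x := by
  have hc : Continuous (stoneCechUnit ∘ i : X → StoneCech Y) :=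
    continuous_stoneCechUnit.comp hi.continuous
  have hemb : Topology.IsClosedEmbedding (stoneCechUnit ∘ i : X → StoneCech Y) := by
    have : T2Space X := hi.t2Space
    exact hc.isClosedEmbedding (isDenseEmbedding_stoneCechUnit.injective.comp hi.injective)
  obtain ⟨g, hg⟩ := f.exists_extension hemb
  exact ⟨g.comp ⟨stoneCechUnit, continuous_stoneCechUnit⟩, fun x => DFunLike.congr_fun hg x⟩

theorem HasDisjointLift.of_countable [CompactSpace X] [T35Space Y] {i : X → Y}
    (hi : Topology.IsEmbedding i) {s : α → Set X}
    (hs : ∀ a, ∃ f : C(X, ℝ), s a = {x | f x ≠ 0}) {S : Set α} (hS : S.Countable) :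
    HasDisjointLift i s S := by
  choose f hf using hs
  choose g hg using fun a => exists_continuous_extension_of_compact hi (f a)
  have : Countable S := hS.to_subtype
  let _ : MetricSpace (S → ℝ) := TopologicalSpace.metrizableSpaceMetric (S → ℝ)
  let H : Y → S → ℝ := fun y a => g a y
  have hH : Continuous H := continuous_pi fun a => (g a).continuous
  -- Extended distances cover empty sets: the distance to `∅` is `∞`.
  let d : Set X → Y → ENNReal := fun U y => Metric.infEDist (H y) ((H ∘ i) '' U)
  have hd : ∀ U, Continuous (d U) := fun U => Metric.continuous_infEDist.comp hH
  have hanti : ∀ {U V : Set X}, U ⊆ V → ∀ y, d V y ≤ d U y := fun h y =>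
    Metric.infEDist_anti (image_mono h)
  have hzero : ∀ (U : Set X) x, x ∈ U → d U (i x) = 0 := fun U x hx =>
    Metric.infEDist_zero_of_mem (mem_image_of_mem (H ∘ i) hx)
  refine ⟨fun a => {y | d (s a) y < d (s a)ᶜ y}, fun a _ => isOpen_lt (hd _) (hd _),
    fun a _ b _ hab => ?_, fun a ha => ⟨fun x hx => ?_, fun x hx => subset_closure ?_⟩⟩
  · rw [Set.disjoint_left]
    intro y hya hyb
    change d (s a) y < d (s a)ᶜ y at hya
    change d (s b) y < d (s b)ᶜ y at hyb
    have h1 := hanti hab.subset_compl_right y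
    have h2 := hanti hab.subset_compl_left y
    exact absurd ((hya.trans_le h2).trans (hyb.trans_le h1)) (lt_irrefl _)
  · by_contra hxa
    have hx' : d (s a) (i x) < d (s a)ᶜ (i x) := hx
    rw [hzero (s a)ᶜ x hxa] at hx'
    exact not_lt_zero hx'
  · change d (s a) (i x) < d (s a)ᶜ (i x)
    rw [hzero _ x hx, pos_iff_ne_zero]
    intro h0
    have hmem : H (i x) ∈ closure ((H ∘ i) '' (s a)ᶜ) := Metric.mem_closure_iff_infEDist_zero.2 h0
    -- Coordinate `a` vanishes on the image of the complement, but not at `H (i x)`.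
    have hsub : closure ((H ∘ i) '' (s a)ᶜ) ⊆ {m | m ⟨a, ha⟩ = 0} := by
      refine closure_minimal ?_ (isClosed_eq (continuous_apply _) continuous_const)
      rintro _ ⟨z, hz, rfl⟩
      rw [hf] at hz
      simpa [H, hg] using hz
    have h3 : g a (i x) = 0 := hsub hmem
    rw [hf] at hx
    exact hx ((hg a x).symm.trans h3)

end CountableFamilies

/-! ### From winning strategies to regular families -/

section Game

variable {X : Type*} [TopologicalSpace X]

theorem exists_play {α : Type*} (τ : List α → α) (resp : α → α) :
    ∃ U : ℕ → α, ∀ n, U n = resp (τ ((List.range n).map U)) := by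
  let L : ℕ → List α := fun n => n.rec [] fun _ l => l ++ [resp (τ l)]
  have hL : ∀ n, (List.range n).map (fun m => resp (τ (L m))) = L n := by
    intro n
    induction n with
    | zero => rfl
    | succ n ih => rw [List.range_succ, List.map_append, ih]; rfl
  exact ⟨fun n => resp (τ (L n)), fun n => by rw [hL]⟩

/-- For a winning strategy, every family closed under the strategy and refining its own
intersections is regular. -/
theorem isRegularSubfamily_of_isWinning {α : Type*} {σ : OpenOpenStrategy X} (hσ : σ.IsWinning)
    {t : α → NonemptyOpen X} {τ : List α → α}
    (hτ : ∀ l, (t (τ l)).toSet ⊆ (σ (l.map t)).toSet) {S : Set α}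
    (hS : ∀ l : List α, (∀ a ∈ l, a ∈ S) → τ l ∈ S)
    (hinter : ∀ a ∈ S, ∀ b ∈ S, ((t a).toSet ∩ (t b).toSet).Nonempty →
      ∃ c ∈ S, (t c).toSet ⊆ (t a).toSet ∩ (t b).toSet) :
    IsRegularSubfamily (fun a => (t a).toSet) S := by
  intro U hU hUne
  by_contra! hcon
  -- Player II answers `a` inside its intersection with a member of `S` that misses `U`.
  have hresp : ∀ a, ∃ c, a ∈ S →
      c ∈ S ∧ (t c).toSet ⊆ (t a).toSet ∧ Disjoint (t c).toSet U := by
    intro a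
    by_cases ha : a ∈ S
    · obtain ⟨b, hb, hbU, hba⟩ := hcon a ha
      obtain ⟨c, hc, hcs⟩ := hinter b hb a ha (Set.not_disjoint_iff_nonempty_inter.1 hba)
      exact ⟨c, fun _ => ⟨hc, fun x hx => (hcs hx).2, hbU.mono_left fun x hx => (hcs hx).1⟩⟩
    · exact ⟨a, fun h => (ha h).elim⟩
  choose resp hresp using hresp
  obtain ⟨W, hW⟩ := exists_play τ resp
  have hmem : ∀ n, W n ∈ S := by
    intro n
    induction n using Nat.strong_induction_on with
    | _ n ih =>
      rw [hW]
      refine (hresp _ (hS _ fun a ha => ?_)).1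
      obtain ⟨m, hm, rfl⟩ := List.mem_map.1 ha
      exact ih m (List.mem_range.1 hm)
  have hmove : ∀ n, τ ((List.range n).map W) ∈ S := fun n => hS _ fun a ha => by
    obtain ⟨m, -, rfl⟩ := List.mem_map.1 ha
    exact hmem m
  have hplay : σ.IsPlay fun n => t (W n) := by
    intro n
    change (t (W n)).toSet ⊆ _
    rw [hW n]
    refine (hresp _ (hmove n)).2.1.trans ((hτ _).trans ?_)
    rw [List.map_map]
    rfl
  obtain ⟨x, hxU, hx⟩ := (hσ _ hplay).inter_open_nonempty U hU hUne
  obtain ⟨n, hn⟩ := mem_iUnion.1 hx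
  change x ∈ (t (W n)).toSet at hn
  rw [hW n] at hn
  exact Set.disjoint_left.1 (hresp _ (hmove n)).2.2 hn hxU

/-- The nonempty cozero sets of `X`. -/
abbrev CozeroOpen (X : Type*) [TopologicalSpace X] : Type _ :=
  {U : NonemptyOpen X // ∃ f : C(X, ℝ), U.toSet = {x | f x ≠ 0}}

theorem exists_cozeroOpen_subset [CompletelyRegularSpace X] {U : Set X} (hU : IsOpen U)
    (hne : U.Nonempty) : ∃ V : CozeroOpen X, V.1.toSet ⊆ U := by
  obtain ⟨x, hx⟩ := hne
  obtain ⟨f, hf, hfx, hfU⟩ := CompletelyRegularSpace.completely_regular x Uᶜ hU.isClosed_compl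
    (fun h => h hx)
  let g : C(X, ℝ) := ⟨fun z => 1 - (f z : ℝ), by fun_prop⟩
  have hg : IsOpen {z | g z ≠ 0} := isOpen_ne_fun g.continuous continuous_const
  refine ⟨⟨⟨⟨{z | g z ≠ 0}, hg⟩, x, ?_⟩, g, rfl⟩, fun z hz => ?_⟩
  · simp [g, hfx]
  · by_contra hzU
    refine hz ?_
    simp [g, hfU hzU]

/-- Finitary operations on the nonempty cozero sets of an I-favorable space, such that all
families closed under them are regular. -/
theorem IFavorable.exists_operations [CompletelyRegularSpace X] (hX : IFavorable X) :
    ∃ F : Bool → List (CozeroOpen X) → CozeroOpen X, ∀ S, IsClosedUnderLists F S →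
      IsRegularSubfamily (fun a : CozeroOpen X => a.1.toSet) S := by
  classical
  obtain ⟨σ, hσ⟩ := hX
  have hτ : ∀ l : List (CozeroOpen X), ∃ V : CozeroOpen X,
      V.1.toSet ⊆ (σ (l.map Subtype.val)).toSet := fun l =>
    exists_cozeroOpen_subset (σ _).1.isOpen (σ _).2
  choose τ hτ using hτ
  have hρ : ∀ l : List (CozeroOpen X), ∃ V : CozeroOpen X,
      (⋂ a ∈ l, a.1.toSet).Nonempty → V.1.toSet ⊆ ⋂ a ∈ l, a.1.toSet := by
    intro l
    by_cases h : (⋂ a ∈ l, a.1.toSet).Nonempty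
    · have ho : IsOpen (⋂ a ∈ l, a.1.toSet) := by
        have := isOpen_biInter_finset (s := l.toFinset) (f := fun a : CozeroOpen X => a.1.toSet)
          fun a _ => a.1.1.isOpen
        simpa using this
      obtain ⟨V, hV⟩ := exists_cozeroOpen_subset ho h
      exact ⟨V, fun _ => hV⟩
    · exact ⟨τ [], fun h' => (h h').elim⟩
  choose ρ hρ using hρ
  -- `true` follows the strategy within cozero sets; `false` refines finite intersections.
  refine ⟨fun k => cond k τ ρ, fun S hS =>
    isRegularSubfamily_of_isWinning hσ hτ (hS true) fun a ha b hb hab =>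
      ⟨ρ [a, b], hS false _ (by simp [ha, hb]), ?_⟩⟩
  simpa using hρ [a, b] (by simpa using hab)

end Game

/-! ### Induction on cardinality -/

-- Enumerate an uncountable `S` along its initial ordinal and close the initial segments under `F`.
-- Uncountability keeps these closures smaller than `S`; unions of chains of closed families are
-- closed, hence regular, so gluing applies.
open Cardinal in
theorem HasDisjointLift.of_isClosedUnderLists {X Y α : Type*} [TopologicalSpace X]
    [TopologicalSpace Y] [CompactSpace X] [T35Space Y] {i : X → Y} (hi : Topology.IsEmbedding i)
    {s : α → Set X} (hne : ∀ a, (s a).Nonempty)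
    (hs : ∀ a, ∃ f : C(X, ℝ), s a = {x | f x ≠ 0}) {F : Bool → List α → α}
    (hF : ∀ S, IsClosedUnderLists F S → IsRegularSubfamily s S) (S : Set α)
    (hS : IsClosedUnderLists F S) : HasDisjointLift i s S := by
  have hopen : ∀ a, IsOpen (s a) := fun a => by
    obtain ⟨f, hf⟩ := hs a
    rw [hf]
    exact isOpen_ne_fun f.continuous continuous_const
  induction hκ : #S using WellFoundedLT.induction generalizing S with
  | ind κ ih =>
    subst hκ
    rcases le_or_gt #S ℵ₀ with hle | hlt
    · exact HasDisjointLift.of_countable hi hs (le_aleph0_iff_set_countable.1 hle)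
    · let ι := (#S).ord.ToType
      have hι : #ι = #S := by simp [ι]
      obtain ⟨c⟩ := Cardinal.eq.1 hι
      have : Nonempty ι := by
        rw [← mk_ne_zero_iff, hι]
        exact (aleph0_pos.trans hlt).ne'
      let C : ι → Set α := fun j => listClosure F ((fun k => (c k : α)) '' Iic j)
      have hCS : ∀ j, C j ⊆ S := fun j => listClosure_subset (by
        rintro _ ⟨k, -, rfl⟩
        exact (c k).2) hS
      have hmono : Monotone C := fun j k hjk =>
        listClosure_subset ((image_mono (Iic_subset_Iic.2 hjk)).trans (subset_listClosure _ _))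
          (isClosedUnderLists_listClosure _ _)
      have hunion : ⋃ j, C j = S := by
        refine Subset.antisymm (iUnion_subset hCS) fun a ha => ?_
        refine mem_iUnion.2 ⟨c.symm ⟨a, ha⟩, subset_listClosure _ _ ⟨_, self_mem_Iic, ?_⟩⟩
        simp
      have hcard : ∀ j, #(C j) < #S := by
        intro j
        refine (mk_listClosure_le F _).trans_lt (max_lt (mk_image_le.trans_lt ?_) hlt)
        have hIio : #(Iio j) < #S := (mk_Iio_lt j (by simp [ι])).trans_eq hι
        rw [← Iio_insert]
        exact (mk_insert_le).trans_lt
          (add_lt_of_lt hlt.le hIio (one_lt_aleph0.trans hlt))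
      rw [← hunion]
      refine HasDisjointLift.iUnion hi.continuous hopen hne
        (fun j => ih _ (hcard j) (C j) (isClosedUnderLists_listClosure _ _) rfl) fun j hj => ?_
      have : Nonempty (Iio j) := let ⟨k, hk⟩ := hj; ⟨⟨k, hk⟩⟩
      exact hF _ (IsClosedUnderLists.iUnion (fun k m hkm => hmono hkm)
        fun k => isClosedUnderLists_listClosure _ _)

/-- A disjointness preserving lift of a π-base yields a π-regular operator. -/
theorem HasDisjointLift.isPiRegularEmbedding {X Y α : Type*} [TopologicalSpace X]
    [TopologicalSpace Y] {i : X → Y} (hi : Topology.IsEmbedding i) {s : α → Set X}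
    (hne : ∀ a, (s a).Nonempty)
    (hbase : ∀ U : Set X, IsOpen U → U.Nonempty → ∃ a, s a ⊆ U)
    (h : HasDisjointLift i s univ) : IsPiRegularEmbedding i := by
  obtain ⟨e, heo, hed, hes⟩ := h
  refine ⟨hi, fun U => ⟨⋃ a : {a // s a ⊆ U}, e a, isOpen_iUnion fun a => heo _ trivial⟩,
    fun U V hUV => ?_, fun U => ⟨fun x hx => ?_, fun x hx => ?_⟩⟩
  · rw [← Set.disjoint_iff_inter_eq_empty] at hUV ⊢
    simp only [Opens.coe_mk, disjoint_iUnion_left, disjoint_iUnion_right]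
    exact fun a b => hed _ trivial _ trivial (hUV.mono b.2 a.2)
  · obtain ⟨a, ha⟩ := mem_iUnion.1 hx
    exact a.2 ((hes a trivial).1 ha)
  · rw [mem_closure_iff]
    intro O hO hxO
    obtain ⟨a, ha⟩ := hbase (O ∩ U) (hO.inter U.isOpen) ⟨x, hxO, hx⟩
    obtain ⟨z, hz⟩ := hne a
    obtain ⟨w, hwa, hwe⟩ := mem_closure_iff.1 ((hes a trivial).2 hz) O hO (ha hz).1
    exact ⟨w, hwa, mem_iUnion.2 ⟨⟨a, ha.trans inter_subset_right⟩, hwe⟩⟩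

theorem proposition2p7 (X : Type*) [TopologicalSpace X] [T35Space X] [CompactSpace X]
    (hX : IFavorable X)
    (Y : Type*) [TopologicalSpace Y] [T35Space Y]
    (i : X → Y) (hi : Topology.IsEmbedding i) :
    IsPiRegularEmbedding i := by
  obtain ⟨F, hF⟩ := hX.exists_operations
  exact HasDisjointLift.isPiRegularEmbedding hi (fun a => a.1.2)
    (fun U hU hne => exists_cozeroOpen_subset hU hne)
    (HasDisjointLift.of_isClosedUnderLists hi (fun a => a.1.2) (fun a => a.2) hF univ
      fun _ _ _ => trivial)
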